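/- Let $n\ge 1$, $\alpha\in(0,1)$ and $p\in[1,\infty)$. For $\varphi\in C_c^\infty(\mathbb{R}^n)$ let $$\nabla^\alpha\varphi(x)=\mu_{n,\alpha}\int_{\mathbb{R}^n}\frac{\varphi(y)-\varphi(x)}{|y-x|^{n+\alpha}}\,\frac{y-x}{|y-x|}\,dy,\qquad \mu_{n,\alpha}=2^\alpha\pi^{-n/2}\,\frac{\Gamma((n+\alpha+1)/2)}{\Gamma((1-\alpha)/2)},$$ be its Riesz fractional gradient. For $u\in L^p(\mathbb{R}^n)$, a field $v\in L^1_{loc}(\mathbb{R}^n;\mathbb{R}^n)$ is the weak fractional gradient of $u$, written $v=\nabla^\alpha u$, if $\int_{\mathbb{R}^n} v\,\varphi\,dx=-\int_{\mathbb{R}^n}u\,\nabla^\alpha\varphi\,dx$ for all $\varphi\in C_c^\infty(\mathbb{R}^n)$; it is unique almost everywhere. Let $S^{\alpha,p}(\mathbb{R}^n)=\{u\in L^p(\mathbb{R}^n):\nabla^\alpha u\in L^p(\mathbb{R}^n;\mathbb{R}^n)\}$. For $\Omega\subset\mathbb{R}^n$ open and bounded and $g\in S^{\alpha,p}(\mathbb{R}^n)$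 let $$S^{\alpha,p}_g(\Omega)=g+\{w\in S^{\alpha,p}(\mathbb{R}^n): w=0\text{ a.e. in }\Omega^c\}.$$ We say that $u_j\rightharpoonup u$ in $S^{\alpha,p}_g(\Omega)$ if $u_j,u\in S^{\alpha,p}_g(\Omega)$ for all $j\in\mathbb{N}$, $u_j\rightharpoonup u$ weakly in $L^p(\mathbb{R}^n)$ and $\nabla^\alpha u_j\rightharpoonup\nabla^\alpha u$ weakly in $L^p(\mathbb{R}^n;\mathbb{R}^n)$. **Lemma.** Let $\Omega\subset\mathbb{R}^n$ be open and bounded, let $g\in S^{\alpha,p}(\mathbb{R}^n)$, and suppose that $u_j\rightharpoonup u$ in $S^{\alpha,p}_g(\Omega)$. Then $$\nabla^\alpha u_j\to\nabla^\alpha u\quad\text{strongly in } L^p((\Omega')^c;\mathbb{R}^n)$$ for every open set $\Omega'\subset\mathbb{R}^n$ with $\Omega\Subset\Omega'$, that is, such that $\overline{\Omega}$ is compact and contained in $\Omega'$. -/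

import Mathlib

open MeasureTheory Filter Topology
open scoped ENNReal

noncomputable section

/-- The constant `μ_{n,α} = 2^α π^{-n/2} Γ((n+α+1)/2) / Γ((1-α)/2)`. -/
def rieszConst (n : ℕ) (α : ℝ) : ℝ :=
  (2 : ℝ) ^ α * Real.pi ^ (-(n : ℝ) / 2) *
    (Real.Gamma (((n : ℝ) + α + 1) / 2) / Real.Gamma ((1 - α) / 2))

/-- The Riesz fractional gradient of a bounded Lipschitz function `φ` on `ℝⁿ`,
`∇^α φ(x) = μ_{n,α} ∫ (φ(y) - φ(x)) / |y - x|^{n+α} · (y - x)/|y - x| dy`. -/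
def rieszGrad {n : ℕ} (α : ℝ) (φ : EuclideanSpace ℝ (Fin n) → ℝ)
    (x : EuclideanSpace ℝ (Fin n)) : EuclideanSpace ℝ (Fin n) :=
  rieszConst n α •
    ∫ y, ((φ y - φ x) / ‖y - x‖ ^ ((n : ℝ) + α)) • (‖y - x‖⁻¹ • (y - x))

/-- `v ∈ L¹_loc(ℝⁿ; ℝⁿ)` is a weak `α`-fractional gradient of `u` (a function in `L¹ + L^∞`):
`∫ v φ = - ∫ u ∇^α φ` for all `φ ∈ C_c^∞(ℝⁿ)`. -/
def IsWeakRieszGrad {n : ℕ} (α : ℝ) (u : EuclideanSpace ℝ (Fin n) → ℝ)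
    (v : EuclideanSpace ℝ (Fin n) → EuclideanSpace ℝ (Fin n)) : Prop :=
  LocallyIntegrable v volume ∧
    ∀ φ : EuclideanSpace ℝ (Fin n) → ℝ, ContDiff ℝ (⊤ : ℕ∞) φ → HasCompactSupport φ →
      ∫ x, φ x • v x = -∫ x, u x • rieszGrad α φ x

/-- Weak fractional gradients are unique almost everywhere. -/
theorem IsWeakRieszGrad.ae_eq {n : ℕ} {α : ℝ} {u : EuclideanSpace ℝ (Fin n) → ℝ}
    {v w : EuclideanSpace ℝ (Fin n) → EuclideanSpace ℝ (Fin n)}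
    (hv : IsWeakRieszGrad α u v) (hw : IsWeakRieszGrad α u w) : v =ᵐ[volume] w :=
  ae_eq_of_integral_contDiff_smul_eq hv.1 hw.1
    fun φ hφ hc => (hv.2 φ hφ hc).trans (hw.2 φ hφ hc).symm

/-- The fractional Sobolev space `S^{α,p}(ℝⁿ)`: all `u ∈ L^p(ℝⁿ)` that have a weak
`α`-fractional gradient in `L^p(ℝⁿ; ℝⁿ)`. -/
def fracSobolev (n : ℕ) (α : ℝ) (p : ℝ≥0∞) :
    Set (Lp ℝ p (volume : Measure (EuclideanSpace ℝ (Fin n)))) :=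
  {u | ∃ v : Lp (EuclideanSpace ℝ (Fin n)) p
      (volume : Measure (EuclideanSpace ℝ (Fin n))), IsWeakRieszGrad α u v}

open Classical in
/-- The weak fractional gradient `∇^α u ∈ L^p(ℝⁿ; ℝⁿ)` of `u ∈ S^{α,p}(ℝⁿ)`
(and `0` for `u` outside this space). -/
def weakGrad {n : ℕ} (α : ℝ) {p : ℝ≥0∞}
    (u : Lp ℝ p (volume : Measure (EuclideanSpace ℝ (Fin n)))) :
    Lp (EuclideanSpace ℝ (Fin n)) p (volume : Measure (EuclideanSpace ℝ (Fin n))) :=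
  if h : u ∈ fracSobolev n α p then h.choose else 0

theorem isWeakRieszGrad_weakGrad {n : ℕ} {α : ℝ} {p : ℝ≥0∞}
    {u : Lp ℝ p (volume : Measure (EuclideanSpace ℝ (Fin n)))} (h : u ∈ fracSobolev n α p) :
    IsWeakRieszGrad α u (weakGrad α u) := by
  rw [weakGrad, dif_pos h]
  exact h.choose_spec

/-- `S^{α,p}_0(Ω)`: the functions in `S^{α,p}(ℝⁿ)` that vanish a.e. in `Ωᶜ`. -/
def fracSobolevZero {n : ℕ} (α : ℝ) (p : ℝ≥0∞) (Ω : Set (EuclideanSpace ℝ (Fin n))) :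
    Set (Lp ℝ p (volume : Measure (EuclideanSpace ℝ (Fin n)))) :=
  {u | u ∈ fracSobolev n α p ∧ ∀ᵐ x ∂volume, x ∈ Ωᶜ → u x = 0}

/-- The complementary-value space `S^{α,p}_g(Ω) = g + S^{α,p}_0(Ω)`. -/
def fracSobolevCompl {n : ℕ} (α : ℝ) (p : ℝ≥0∞) (Ω : Set (EuclideanSpace ℝ (Fin n)))
    (g : Lp ℝ p (volume : Measure (EuclideanSpace ℝ (Fin n)))) :
    Set (Lp ℝ p (volume : Measure (EuclideanSpace ℝ (Fin n)))) :=
  {u | ∃ w ∈ fracSobolevZero α p Ω, u = g + w}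

/-- Weak convergence of a sequence in a real normed space, tested with the continuous dual. -/
def WeakSeqTendsto {X : Type*} [NormedAddCommGroup X] [NormedSpace ℝ X]
    (x : ℕ → X) (x₀ : X) : Prop :=
  ∀ ℓ : X →L[ℝ] ℝ, Tendsto (fun j => ℓ (x j)) atTop (𝓝 (ℓ x₀))

/-- Weak convergence `u_j ⇀ u` in `S^{α,p}(ℝⁿ)`: `u_j ⇀ u` in `L^p(ℝⁿ)` and
`∇^α u_j ⇀ ∇^α u` in `L^p(ℝⁿ; ℝⁿ)`, all functions belonging to `S^{α,p}(ℝⁿ)`. -/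
def FracWeakTendsto {n : ℕ} (α : ℝ) {p : ℝ≥0∞} [Fact (1 ≤ p)]
    (u : ℕ → Lp ℝ p (volume : Measure (EuclideanSpace ℝ (Fin n))))
    (u₀ : Lp ℝ p (volume : Measure (EuclideanSpace ℝ (Fin n)))) : Prop :=
  (∀ j, u j ∈ fracSobolev n α p) ∧ u₀ ∈ fracSobolev n α p ∧
    WeakSeqTendsto u u₀ ∧ WeakSeqTendsto (fun j => weakGrad α (u j)) (weakGrad α u₀)

/-- Weak convergence `u_j ⇀ u` in `S^{α,p}_g(Ω)`: all functions belong to this space, and the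
sequence converges weakly in `S^{α,p}(ℝⁿ)`. -/
def FracComplWeakTendsto {n : ℕ} (α : ℝ) {p : ℝ≥0∞} [Fact (1 ≤ p)]
    (Ω : Set (EuclideanSpace ℝ (Fin n)))
    (g : Lp ℝ p (volume : Measure (EuclideanSpace ℝ (Fin n))))
    (u : ℕ → Lp ℝ p (volume : Measure (EuclideanSpace ℝ (Fin n))))
    (u₀ : Lp ℝ p (volume : Measure (EuclideanSpace ℝ (Fin n)))) : Prop :=
  (∀ j, u j ∈ fracSobolevCompl α p Ω g) ∧ u₀ ∈ fracSobolevCompl α p Ω g ∧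
    FracWeakTendsto α u u₀

/-- `A ⋐ B`: the closure of `A` is compact and contained in `B`. -/
def CompactlyContained {X : Type*} [TopologicalSpace X] (A B : Set X) : Prop :=
  closure A ⊆ B ∧ IsCompact (closure A)

end

/-!
Set `w j = u j - u₀`. It vanishes almost everywhere outside the bounded set `Ω` and converges
weakly to `0` in `L^p`, and `∇^α (u j) - ∇^α u₀` is a weak fractional gradient of it. Testing with
functions `φ` supported at positive distance from `Ω`, where the kernel of the Riesz gradient is
not singular, Fubini's theorem and the oddness of the kernel `K(h) = h / |h|^{n+α+1}` give
`∇^α (u j) - ∇^α u₀ = μ_{n,α} ∫_Ω w j (y) K(y - x) dy` for almost every such point `x`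
(`IsWeakRieszGrad.ae_eq_rieszPotential`).

For fixed `x` the function `K(· - x)` is bounded on `Ω`, so the right-hand side is a bounded
linear map of `w j ∈ L^p` and tends to `0`. It is also bounded by a multiple of
`‖w j‖_{L^1(Ω)} (1 + |x|)^{-(n+α)}`, where the norms are bounded by the uniform boundedness
principle and the weight lies in `L^p` for every `p ≥ 1`. Dominated convergence finishes the proof
(`tendsto_eLpNorm_rieszPotential_indicator`).

That weak gradients may be subtracted (`IsWeakRieszGrad.sub`) needs `u ∇^α φ` to be integrable for
`u ∈ L^p`; this holds because `∇^α φ ∈ L^1 ∩ L^∞`.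
-/

noncomputable section

/-! ### The Riesz kernel and the gradient of test functions -/

/-- The vector kernel `h / |h|^{n+α+1}` of the Riesz fractional gradient on `ℝⁿ`; it takes the
value `0` at the origin. -/
def rieszKernel {n : ℕ} (α : ℝ) (h : EuclideanSpace ℝ (Fin n)) : EuclideanSpace ℝ (Fin n) :=
  (‖h‖ ^ ((n : ℝ) + α))⁻¹ • (‖h‖⁻¹ • h)

theorem rieszGrad_eq {n : ℕ} (α : ℝ) (φ : EuclideanSpace ℝ (Fin n) → ℝ)
    (x : EuclideanSpace ℝ (Fin n)) :
    rieszGrad α φ x = rieszConst n α • ∫ y, (φ y - φ x) • rieszKernel α (y - x) := by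
  simp only [rieszGrad, rieszKernel, div_eq_mul_inv, mul_smul]

theorem measurable_rieszKernel {n : ℕ} (α : ℝ) : Measurable (rieszKernel (n := n) α) := by
  unfold rieszKernel
  fun_prop

theorem rieszKernel_neg {n : ℕ} (α : ℝ) (h : EuclideanSpace ℝ (Fin n)) :
    rieszKernel α (-h) = -rieszKernel α h := by
  simp [rieszKernel]

theorem norm_rieszKernel_le {n : ℕ} (α : ℝ) (h : EuclideanSpace ℝ (Fin n)) :
    ‖rieszKernel α h‖ ≤ (‖h‖ ^ ((n : ℝ) + α))⁻¹ := by
  have h0 : 0 ≤ (‖h‖ ^ ((n : ℝ) + α))⁻¹ := by positivity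
  rw [rieszKernel, norm_smul, Real.norm_of_nonneg h0, norm_smul, norm_inv, norm_norm]
  exact mul_le_of_le_one_right h0 inv_mul_le_one

theorem norm_rieszKernel_le_of_le {n : ℕ} {α : ℝ} (hα : 0 < α) {h : EuclideanSpace ℝ (Fin n)}
    {r : ℝ} (hr : 0 < r) (hrh : r ≤ ‖h‖) : ‖rieszKernel α h‖ ≤ (r ^ ((n : ℝ) + α))⁻¹ := by
  refine (norm_rieszKernel_le α h).trans ?_
  gcongr

/-- The scalar majorant `min(|h|, 1) / |h|^{n+α}` of the difference quotients of a bounded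
Lipschitz function against the Riesz kernel. -/
def rieszMajorant {n : ℕ} (α : ℝ) (h : EuclideanSpace ℝ (Fin n)) : ℝ :=
  min ‖h‖ 1 * (‖h‖ ^ ((n : ℝ) + α))⁻¹

theorem rieszMajorant_nonneg {n : ℕ} (α : ℝ) (h : EuclideanSpace ℝ (Fin n)) :
    0 ≤ rieszMajorant α h := by
  unfold rieszMajorant; positivity

theorem rieszMajorant_sub_comm {n : ℕ} (α : ℝ) (x y : EuclideanSpace ℝ (Fin n)) :
    rieszMajorant α (x - y) = rieszMajorant α (y - x) := by
  simp only [rieszMajorant, norm_sub_rev x y]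

/-- In polar coordinates, with the weight `r^{n-1}`, the majorant becomes `r^{-α}` on `(0, 1)` and
`r^{-1-α}` on `[1, ∞)`. -/
theorem integrable_rieszMajorant {n : ℕ} (hn : 0 < n) {α : ℝ} (hα0 : 0 < α) (hα1 : α < 1) :
    Integrable (rieszMajorant (n := n) α) := by
  have : Nonempty (Fin n) := ⟨⟨0, hn⟩⟩
  have : Nontrivial (EuclideanSpace ℝ (Fin n)) := by
    apply Module.nontrivial_of_finrank_pos (R := ℝ)
    simpa using hn
  refine (integrable_fun_norm_addHaar (E := EuclideanSpace ℝ (Fin n)) volume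
    (f := fun r : ℝ => min r 1 * (r ^ ((n : ℝ) + α))⁻¹)).2 ?_
  rw [finrank_euclideanSpace_fin]
  have hpow : ∀ r : ℝ, 0 < r → r ^ (n - 1) * (r ^ ((n : ℝ) + α))⁻¹ = r ^ (-1 - α) := by
    intro r hr
    rw [← Real.rpow_natCast, ← Real.rpow_neg hr.le, ← Real.rpow_add hr]
    congr 1
    rw [Nat.cast_sub hn]; push_cast; ring
  rw [← Set.Ioo_union_Ici_eq_Ioi (zero_lt_one' ℝ)]
  refine IntegrableOn.union ?_ ?_
  · refine ((intervalIntegral.integrableOn_Ioo_rpow_iff (s := -α) zero_lt_one).2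
      (by linarith)).congr_fun ?_ measurableSet_Ioo
    intro r hr
    have := hpow r hr.1
    simp only [smul_eq_mul, min_eq_left hr.2.le]
    rw [show r ^ (n - 1) * (r * (r ^ ((n : ℝ) + α))⁻¹)
      = r * (r ^ (n - 1) * (r ^ ((n : ℝ) + α))⁻¹) by ring, this,
      show -α = 1 + (-1 - α) by ring, Real.rpow_add hr.1, Real.rpow_one]
  · rw [integrableOn_Ici_iff_integrableOn_Ioi]
    refine ((integrableOn_Ioi_rpow_iff (s := -1 - α) zero_lt_one).2
      (by linarith)).congr_fun ?_ measurableSet_Ioi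
    intro r hr
    have hr' : (1 : ℝ) < r := hr
    simp only [smul_eq_mul, min_eq_right hr'.le, one_mul]
    exact (hpow r (by linarith)).symm

/-- A Lipschitz function of compact support is bounded, so its increments are controlled by
`min(|h|, 1)`. -/
theorem exists_abs_sub_le_min {n : ℕ} {φ : EuclideanSpace ℝ (Fin n) → ℝ}
    (hφ : ContDiff ℝ (⊤ : ℕ∞) φ) (hc : HasCompactSupport φ) :
    ∃ K : ℝ, 0 ≤ K ∧ ∀ x y, |φ y - φ x| ≤ K * min ‖y - x‖ 1 := by
  obtain ⟨L, hL⟩ := ContDiff.lipschitzWith_of_hasCompactSupport hc hφ (by simp)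
  obtain ⟨M, hM⟩ := hφ.continuous.bounded_above_of_compact_support hc
  have hM0 : 0 ≤ M := (norm_nonneg _).trans (hM 0)
  refine ⟨L + 2 * M, by positivity, fun x y => ?_⟩
  have h1 : |φ y - φ x| ≤ L * ‖y - x‖ := by
    have := hL.dist_le_mul y x
    rwa [Real.dist_eq, dist_eq_norm] at this
  have h2 : |φ y - φ x| ≤ 2 * M := by
    have := norm_sub_le (φ y) (φ x)
    rw [Real.norm_eq_abs] at this
    linarith [hM y, hM x]
  have hL0 : (0 : ℝ) ≤ L := L.2
  rcases le_total ‖y - x‖ 1 with h | h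
  · rw [min_eq_left h]; nlinarith [norm_nonneg (y - x)]
  · rw [min_eq_right h]; linarith

theorem norm_sub_smul_rieszKernel_le {n : ℕ} (α : ℝ) {φ : EuclideanSpace ℝ (Fin n) → ℝ} {K : ℝ}
    (hK : ∀ x y, |φ y - φ x| ≤ K * min ‖y - x‖ 1) (x y : EuclideanSpace ℝ (Fin n)) :
    ‖(φ y - φ x) • rieszKernel α (y - x)‖ ≤ K * rieszMajorant α (y - x) := by
  rw [norm_smul, rieszMajorant, ← mul_assoc, Real.norm_eq_abs]
  have := (abs_nonneg _).trans (hK x y)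
  gcongr
  · exact hK x y
  · exact norm_rieszKernel_le α _

theorem measurable_sub_smul_rieszKernel {n : ℕ} (α : ℝ) {φ : EuclideanSpace ℝ (Fin n) → ℝ}
    (hφ : Continuous φ) :
    Measurable fun q : EuclideanSpace ℝ (Fin n) × EuclideanSpace ℝ (Fin n) =>
      (φ q.2 - φ q.1) • rieszKernel α (q.2 - q.1) := by
  have h1 := (measurable_rieszKernel (n := n) α).comp
    ((measurable_snd (α := EuclideanSpace ℝ (Fin n)) (β := EuclideanSpace ℝ (Fin n))).sub
      measurable_fst)
  have h2 := hφ.measurable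
  exact ((h2.comp measurable_snd).sub (h2.comp measurable_fst)).smul h1

theorem exists_norm_rieszGrad_le {n : ℕ} (hn : 0 < n) {α : ℝ} (hα0 : 0 < α) (hα1 : α < 1)
    {φ : EuclideanSpace ℝ (Fin n) → ℝ} (hφ : ContDiff ℝ (⊤ : ℕ∞) φ) (hc : HasCompactSupport φ) :
    ∃ C, ∀ x, ‖rieszGrad α φ x‖ ≤ C := by
  obtain ⟨K, -, hK⟩ := exists_abs_sub_le_min hφ hc
  refine ⟨‖rieszConst n α‖ * ∫ h, K * rieszMajorant (n := n) α h, fun x => ?_⟩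
  rw [rieszGrad_eq, norm_smul]
  gcongr
  rw [← integral_sub_right_eq_self (fun h => K * rieszMajorant (n := n) α h) x]
  refine norm_integral_le_of_norm_le ?_ (.of_forall (norm_sub_smul_rieszKernel_le α hK x))
  exact ((integrable_rieszMajorant hn hα0 hα1).const_mul K).comp_sub_right x

/-- The difference quotient `(φ y - φ x) K(y - x)` vanishes unless `x` or `y` lies in the support
of `φ`, so it is integrable in both variables together. -/
theorem integrable_rieszGrad {n : ℕ} (hn : 0 < n) {α : ℝ} (hα0 : 0 < α) (hα1 : α < 1)
    {φ : EuclideanSpace ℝ (Fin n) → ℝ} (hφ : ContDiff ℝ (⊤ : ℕ∞) φ) (hc : HasCompactSupport φ) :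
    Integrable (rieszGrad α φ) := by
  obtain ⟨K, hK0, hK⟩ := exists_abs_sub_le_min hφ hc
  have hm := integrable_rieszMajorant hn hα0 hα1
  have hS : Integrable ((tsupport φ).indicator fun _ => (1 : ℝ)) :=
    (integrable_indicator_iff (isClosed_tsupport φ).measurableSet).2
      (integrableOn_const hc.measure_lt_top.ne)
  have hconv := hS.convolution_integrand (ContinuousLinearMap.mul ℝ ℝ) hm
  have key : Integrable (fun q : EuclideanSpace ℝ (Fin n) × EuclideanSpace ℝ (Fin n) =>
      (φ q.2 - φ q.1) • rieszKernel α (q.2 - q.1)) (volume.prod volume) := by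
    refine ((hconv.add hconv.swap).const_mul K).mono'
      (measurable_sub_smul_rieszKernel α hφ.continuous).aestronglyMeasurable
      (.of_forall fun q => ?_)
    have hb := norm_sub_smul_rieszKernel_le α hK q.1 q.2
    have h0 := rieszMajorant_nonneg α (q.2 - q.1)
    simp only [Pi.add_apply, Function.comp, ContinuousLinearMap.mul_apply', Prod.fst_swap,
      Prod.snd_swap]
    rw [rieszMajorant_sub_comm α q.1 q.2, ← add_mul]
    by_cases h1 : q.1 ∈ tsupport φ
    · by_cases h2 : q.2 ∈ tsupport φ
      · rw [Set.indicator_of_mem h1, Set.indicator_of_mem h2]; nlinarith [mul_nonneg hK0 h0]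
      · rw [Set.indicator_of_mem h1, Set.indicator_of_notMem h2]; simpa using hb
    · by_cases h2 : q.2 ∈ tsupport φ
      · rw [Set.indicator_of_notMem h1, Set.indicator_of_mem h2]; simpa using hb
      · rw [image_eq_zero_of_notMem_tsupport h1, image_eq_zero_of_notMem_tsupport h2,
          Set.indicator_of_notMem h1, Set.indicator_of_notMem h2]
        simp
  have : rieszGrad α φ
      = fun x => rieszConst n α • ∫ y, (φ y - φ x) • rieszKernel α (y - x) :=
    funext (rieszGrad_eq α φ)
  rw [this]
  exact key.integral_prod_left.smul (rieszConst n α)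

/-- Since `rieszGrad α φ` lies in `L¹ ∩ L^∞`, the bound `|u| ≤ 1 + |u|^p` suffices. -/
theorem integrable_smul_rieszGrad {n : ℕ} (hn : 0 < n) {α : ℝ} (hα0 : 0 < α) (hα1 : α < 1)
    {p : ℝ≥0∞} (hp1 : 1 ≤ p) (hp : p ≠ ⊤) {u : EuclideanSpace ℝ (Fin n) → ℝ}
    (hu : MemLp u p volume)
    {φ : EuclideanSpace ℝ (Fin n) → ℝ} (hφ : ContDiff ℝ (⊤ : ℕ∞) φ) (hc : HasCompactSupport φ) :
    Integrable (fun x => u x • rieszGrad α φ x) := by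
  obtain ⟨C, hC⟩ := exists_norm_rieszGrad_le hn hα0 hα1 hφ hc
  have hG := integrable_rieszGrad hn hα0 hα1 hφ hc
  have hC0 : 0 ≤ C := (norm_nonneg _).trans (hC 0)
  have hup := hu.integrable_norm_rpow (by positivity) hp
  have hp1' : 1 ≤ p.toReal := by
    rw [← ENNReal.toReal_one]
    exact (ENNReal.toReal_le_toReal ENNReal.one_ne_top hp).2 hp1
  refine (hG.norm.add (hup.const_mul C)).mono' (hu.1.smul hG.1) (.of_forall fun x => ?_)
  simp only [Pi.add_apply]
  rw [norm_smul]
  have h0 : 0 ≤ ‖u x‖ ^ p.toReal := by positivity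
  rcases le_total ‖u x‖ 1 with h | h
  · nlinarith [norm_nonneg (rieszGrad α φ x), mul_nonneg hC0 h0]
  · have h2 : ‖u x‖ ≤ ‖u x‖ ^ p.toReal := by
      simpa using Real.rpow_le_rpow_of_exponent_le h hp1'
    have h3 := mul_le_mul h2 (hC x) (norm_nonneg _) h0
    nlinarith [norm_nonneg (rieszGrad α φ x)]

theorem IsWeakRieszGrad.sub {n : ℕ} (hn : 0 < n) {α : ℝ} (hα0 : 0 < α) (hα1 : α < 1)
    {p : ℝ≥0∞} (hp1 : 1 ≤ p) (hp : p ≠ ⊤) {u u' : EuclideanSpace ℝ (Fin n) → ℝ}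
    {v v' : EuclideanSpace ℝ (Fin n) → EuclideanSpace ℝ (Fin n)}
    (hu : MemLp u p volume) (hu' : MemLp u' p volume)
    (hv : IsWeakRieszGrad α u v) (hv' : IsWeakRieszGrad α u' v') :
    IsWeakRieszGrad α (u - u') (v - v') := by
  refine ⟨hv.1.sub hv'.1, fun φ hφ hc => ?_⟩
  have e := hv.2 φ hφ hc
  have e' := hv'.2 φ hφ hc
  simp only [Pi.sub_apply, smul_sub, sub_smul]
  rw [integral_sub (hv.1.integrable_smul_left_of_hasCompactSupport hφ.continuous hc)
      (hv'.1.integrable_smul_left_of_hasCompactSupport hφ.continuous hc),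
    integral_sub (integrable_smul_rieszGrad hn hα0 hα1 hp1 hp hu hφ hc)
      (integrable_smul_rieszGrad hn hα0 hα1 hp1 hp hu' hφ hc), e, e']
  abel

/-! ### The potential representation away from the support -/

/-- The fractional gradient of `w` written as the potential `μ_{n,α} ∫ w(y) K(y - x) dy`; this is
the Riesz fractional gradient of `w` at points `x` that have positive distance to the support
of `w`. -/
def rieszPotential {n : ℕ} (α : ℝ) (w : EuclideanSpace ℝ (Fin n) → ℝ)
    (x : EuclideanSpace ℝ (Fin n)) : EuclideanSpace ℝ (Fin n) :=
  rieszConst n α • ∫ y, w y • rieszKernel α (y - x)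

/-- Duality of the gradient and the potential for separated supports. Separation keeps the double
integral away from the singularity of the kernel, so that Fubini's theorem applies, and the sign
comes from the kernel being odd. -/
theorem integral_smul_rieszGrad_eq_neg {n : ℕ} {α : ℝ} (hα : 0 < α)
    {w φ : EuclideanSpace ℝ (Fin n) → ℝ} (hw : Integrable w) (hφ : Integrable φ)
    {δ : ℝ} (hδ : 0 < δ) (hsep : ∀ y z, w y ≠ 0 → φ z ≠ 0 → δ ≤ ‖z - y‖) :
    ∫ y, w y • rieszGrad α φ y = -∫ z, φ z • rieszPotential α w z := by
  have hL : ∀ y, w y • rieszGrad α φ y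
      = rieszConst n α • ∫ z, (w y * φ z) • rieszKernel α (z - y) := by
    intro y
    by_cases hy : w y = 0
    · simp [hy]
    · have hφy : φ y = 0 := by
        by_contra h
        have := hsep y y hy h
        simp only [sub_self, norm_zero] at this
        linarith
      rw [rieszGrad_eq, smul_comm, ← integral_smul]
      simp only [hφy, sub_zero, smul_smul]
  have hR : ∀ z, φ z • rieszPotential α w z
      = -(rieszConst n α • ∫ y, (w y * φ z) • rieszKernel α (z - y)) := by
    intro z
    rw [rieszPotential, smul_comm, ← integral_smul, ← smul_neg, ← integral_neg]
    congr 2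
    ext1 y
    rw [← neg_sub z y, rieszKernel_neg, smul_neg, smul_neg, smul_smul, mul_comm]
  simp only [hL, hR]
  rw [integral_neg, neg_neg, integral_smul, integral_smul, integral_integral_swap]
  have hmeas : AEStronglyMeasurable
      (Function.uncurry fun y z : EuclideanSpace ℝ (Fin n) =>
        (w y * φ z) • rieszKernel α (z - y)) (volume.prod volume) :=
    (hw.mul_prod hφ).1.smul ((measurable_rieszKernel α).comp
      (measurable_snd.sub measurable_fst)).aestronglyMeasurable
  refine ((hw.mul_prod hφ).norm.mul_const (δ ^ ((n : ℝ) + α))⁻¹).mono' hmeas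
    (.of_forall fun q => ?_)
  rw [Function.uncurry, norm_smul]
  by_cases h1 : w q.1 = 0
  · simp [h1]
  by_cases h2 : φ q.2 = 0
  · simp [h2]
  gcongr
  exact norm_rieszKernel_le_of_le hα hδ (hsep _ _ h1 h2)

theorem aestronglyMeasurable_rieszPotential {n : ℕ} {α : ℝ} {w : EuclideanSpace ℝ (Fin n) → ℝ}
    (hw : AEStronglyMeasurable w) : AEStronglyMeasurable (rieszPotential α w) := by
  have h : AEStronglyMeasurable
      (fun q : EuclideanSpace ℝ (Fin n) × EuclideanSpace ℝ (Fin n) =>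
        w q.2 • rieszKernel α (q.2 - q.1)) (volume.prod volume) :=
    hw.comp_snd.smul ((measurable_rieszKernel α).comp
      (measurable_snd.sub measurable_fst)).aestronglyMeasurable
  exact h.integral_prod_right'.const_smul (rieszConst n α)

theorem norm_rieszPotential_le {n : ℕ} {α : ℝ} (hα : 0 < α) {w : EuclideanSpace ℝ (Fin n) → ℝ}
    (hw : Integrable w) {x : EuclideanSpace ℝ (Fin n)} {r : ℝ} (hr : 0 < r)
    (hx : ∀ y, w y ≠ 0 → r ≤ ‖x - y‖) :
    ‖rieszPotential α w x‖ ≤ ‖rieszConst n α‖ * ((∫ y, ‖w y‖) * (r ^ ((n : ℝ) + α))⁻¹) := by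
  rw [rieszPotential, norm_smul, ← integral_mul_const]
  gcongr
  refine norm_integral_le_of_norm_le (hw.norm.mul_const _) (.of_forall fun y => ?_)
  rw [norm_smul]
  by_cases hy : w y = 0
  · simp [hy]
  gcongr
  exact norm_rieszKernel_le_of_le hα hr (by rw [norm_sub_rev]; exact hx y hy)

/-- At distance at least `δ` from a bounded set, distances to that set are comparable to
`1 + |x|`, uniformly in `x`. -/
theorem exists_mul_one_add_norm_le {n : ℕ} {Ω U : Set (EuclideanSpace ℝ (Fin n))}
    (hΩ : Bornology.IsBounded Ω) {δ : ℝ} (hδ : 0 < δ) (hU : ∀ x ∈ U, ∀ y ∈ Ω, δ ≤ ‖x - y‖) :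
    ∃ D : ℝ, 0 < D ∧ ∀ x ∈ U, ∀ y ∈ Ω, D * (1 + ‖x‖) ≤ ‖x - y‖ := by
  obtain ⟨R, hR0, hR⟩ := hΩ.exists_pos_norm_le
  -- `1 + |x| ≤ (1 + R) + |x - y| ≤ ((1 + R) / δ + 1) |x - y|`
  refine ⟨((1 + R) / δ + 1)⁻¹, by positivity, fun x hx y hy => ?_⟩
  rw [inv_mul_le_iff₀ (by positivity)]
  have h1 : ‖x‖ ≤ ‖x - y‖ + ‖y‖ := by simpa using norm_add_le (x - y) y
  have h2 := hU x hx y hy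
  have h3 : 1 + R ≤ (1 + R) / δ * ‖x - y‖ := by
    rw [div_mul_eq_mul_div, le_div_iff₀ hδ]
    gcongr
  linarith [hR y hy]

/-- Away from the support of `u`, the weak fractional gradient is the absolutely convergent
potential. -/
theorem IsWeakRieszGrad.ae_eq_rieszPotential {n : ℕ} {α : ℝ} (hα : 0 < α)
    {u w : EuclideanSpace ℝ (Fin n) → ℝ}
    {v : EuclideanSpace ℝ (Fin n) → EuclideanSpace ℝ (Fin n)} (hv : IsWeakRieszGrad α u v)
    (huw : u =ᵐ[volume] w) (hw : Integrable w) {Ω U : Set (EuclideanSpace ℝ (Fin n))}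
    (hwΩ : ∀ y ∉ Ω, w y = 0) (hU : IsOpen U)
    {δ : ℝ} (hδ : 0 < δ) (hsep : ∀ x ∈ U, ∀ y ∈ Ω, δ ≤ ‖x - y‖) :
    ∀ᵐ x, x ∈ U → v x = rieszPotential α w x := by
  have hmem : ∀ y, w y ≠ 0 → y ∈ Ω := fun y hy => by
    by_contra h
    exact hy (hwΩ y h)
  have hP : LocallyIntegrable (U.indicator (rieszPotential α w)) := by
    refine (locallyIntegrable_const
      (‖rieszConst n α‖ * ((∫ y, ‖w y‖) * (δ ^ ((n : ℝ) + α))⁻¹))).mono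
      ((aestronglyMeasurable_rieszPotential hw.1).indicator hU.measurableSet)
      (.of_forall fun x => ?_)
    rw [Real.norm_of_nonneg (by positivity)]
    by_cases hx : x ∈ U
    · rw [Set.indicator_of_mem hx]
      exact norm_rieszPotential_le hα hw hδ fun y hy => hsep x hx y (hmem y hy)
    · rw [Set.indicator_of_notMem hx, norm_zero]
      positivity
  have key := hU.ae_eq_zero_of_integral_contDiff_smul_eq_zero
    (f := v - U.indicator (rieszPotential α w)) (μ := volume)
    ((hv.1.sub hP).locallyIntegrableOn U) ?_
  · filter_upwards [key] with x hx hxU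
    have := hx hxU
    rwa [Pi.sub_apply, Set.indicator_of_mem hxU, sub_eq_zero] at this
  · intro φ hφ hc hs
    have hφ0 : ∀ z, φ z ≠ 0 → z ∈ U := fun z hz => hs (subset_tsupport φ hz)
    simp only [Pi.sub_apply, smul_sub]
    rw [integral_sub (hv.1.integrable_smul_left_of_hasCompactSupport hφ.continuous hc)
      (hP.integrable_smul_left_of_hasCompactSupport hφ.continuous hc), hv.2 φ hφ hc]
    have e1 : ∫ x, u x • rieszGrad α φ x = ∫ x, w x • rieszGrad α φ x :=
      integral_congr_ae (by filter_upwards [huw] with x hx; rw [hx])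
    have e2 : ∫ x, φ x • U.indicator (rieszPotential α w) x
        = ∫ x, φ x • rieszPotential α w x := by
      congr 1
      ext1 x
      by_cases hx : φ x = 0
      · simp [hx]
      · rw [Set.indicator_of_mem (hφ0 x hx)]
    rw [e1, e2, integral_smul_rieszGrad_eq_neg hα hw
      (hφ.continuous.integrable_of_hasCompactSupport hc) hδ
      fun y z hy hz => hsep z (hφ0 z hz) y (hmem y hy)]
    simp

/-! ### Weak convergence and dominated convergence -/

theorem WeakSeqTendsto.sub_const {X : Type*} [NormedAddCommGroup X] [NormedSpace ℝ X]
    {x : ℕ → X} {x₀ : X} (h : WeakSeqTendsto x x₀) :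
    WeakSeqTendsto (fun j => x j - x₀) 0 := by
  intro ℓ
  simpa using (h ℓ).sub_const (ℓ x₀)

/-- Weakly convergent sequences are bounded, by the uniform boundedness principle in the dual. -/
theorem WeakSeqTendsto.exists_norm_le {X : Type*} [NormedAddCommGroup X] [NormedSpace ℝ X]
    {x : ℕ → X} {x₀ : X} (h : WeakSeqTendsto x x₀) : ∃ C, ∀ j, ‖x j‖ ≤ C := by
  obtain ⟨C, hC⟩ := banach_steinhaus
    (g := fun j => NormedSpace.inclusionInDoubleDualLi ℝ (x j)) fun ℓ => by
      obtain ⟨C, hC⟩ := (h ℓ).norm.bddAbove_range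
      exact ⟨C, fun j => hC ⟨j, rfl⟩⟩
  exact ⟨C, fun j => ((NormedSpace.inclusionInDoubleDualLi ℝ).norm_map (x j)).ge.trans (hC j)⟩

theorem WeakSeqTendsto.tendsto_clm_euclidean {X : Type*} [NormedAddCommGroup X] [NormedSpace ℝ X]
    {x : ℕ → X} {x₀ : X} (h : WeakSeqTendsto x x₀) {n : ℕ}
    (T : X →L[ℝ] EuclideanSpace ℝ (Fin n)) : Tendsto (fun j => T (x j)) atTop (𝓝 (T x₀)) := by
  rw [(EuclideanSpace.equiv (Fin n) ℝ).toHomeomorph.isInducing.tendsto_nhds_iff, tendsto_pi_nhds]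
  exact fun i => h ((EuclideanSpace.proj i : EuclideanSpace ℝ (Fin n) →L[ℝ] ℝ).comp T)

theorem integrableOn_Lp {n : ℕ} {p : ℝ≥0∞} [Fact (1 ≤ p)] {Ω : Set (EuclideanSpace ℝ (Fin n))}
    (hΩ : Bornology.IsBounded Ω)
    (f : Lp ℝ p (volume : Measure (EuclideanSpace ℝ (Fin n)))) : IntegrableOn f Ω := by
  have : IsFiniteMeasure (volume.restrict Ω) := ⟨by simpa using hΩ.measure_lt_top⟩
  exact ((Lp.memLp f).restrict Ω).integrable Fact.out

theorem exists_setIntegral_norm_le {n : ℕ} {p : ℝ≥0∞} [Fact (1 ≤ p)]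
    {Ω : Set (EuclideanSpace ℝ (Fin n))} (hΩ : Bornology.IsBounded Ω) :
    ∃ C : ℝ, 0 ≤ C ∧ ∀ f : Lp ℝ p (volume : Measure (EuclideanSpace ℝ (Fin n))),
      ∫ x in Ω, ‖f x‖ ≤ C * ‖f‖ := by
  have hp : 1 ≤ p := Fact.out
  set m := (volume.restrict Ω) Set.univ ^ (1 / (1 : ℝ≥0∞).toReal - 1 / p.toReal) with hm
  have hm_top : m ≠ ⊤ := by
    refine ENNReal.rpow_ne_top_of_nonneg ?_ (by simpa using hΩ.measure_lt_top.ne)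
    rw [ENNReal.toReal_one, one_div_one, sub_nonneg, one_div]
    rcases eq_or_ne p ⊤ with rfl | hpt
    · simp
    · refine inv_le_one_of_one_le₀ ?_
      rw [← ENNReal.toReal_one]
      exact (ENNReal.toReal_le_toReal ENNReal.one_ne_top hpt).2 hp
  refine ⟨m.toReal, ENNReal.toReal_nonneg, fun f => ?_⟩
  have hf : AEStronglyMeasurable f (volume.restrict Ω) := (Lp.aestronglyMeasurable f).restrict
  rw [integral_norm_eq_lintegral_enorm hf, ← eLpNorm_one_eq_lintegral_enorm, Lp.norm_def,
    mul_comm, ← ENNReal.toReal_mul]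
  refine ENNReal.toReal_mono (ENNReal.mul_ne_top (Lp.eLpNorm_ne_top f) hm_top) ?_
  refine (eLpNorm_le_eLpNorm_mul_rpow_measure_univ hp hf).trans ?_
  gcongr
  exact Measure.restrict_le_self

/-- Integration over a bounded set against a bounded vector field is a bounded operator
on `L^p`. -/
theorem exists_clm_setIntegral_smul {n : ℕ} {p : ℝ≥0∞} [Fact (1 ≤ p)]
    {Ω : Set (EuclideanSpace ℝ (Fin n))} (hΩ : Bornology.IsBounded Ω) (hΩm : MeasurableSet Ω)
    {k : EuclideanSpace ℝ (Fin n) → EuclideanSpace ℝ (Fin n)} (hk : Measurable k) {M : ℝ}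
    (hM : ∀ y ∈ Ω, ‖k y‖ ≤ M) :
    ∃ T : Lp ℝ p (volume : Measure (EuclideanSpace ℝ (Fin n))) →L[ℝ] EuclideanSpace ℝ (Fin n),
      ∀ f, T f = ∫ y in Ω, f y • k y := by
  obtain ⟨C, hC0, hC⟩ := exists_setIntegral_norm_le (p := p) hΩ
  have hb : ∀ f : Lp ℝ p (volume : Measure (EuclideanSpace ℝ (Fin n))),
      ∀ᵐ y ∂volume.restrict Ω, ‖f y • k y‖ ≤ ‖f y‖ * M := fun f => by
    filter_upwards [ae_restrict_mem hΩm] with y hy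
    rw [norm_smul]
    gcongr
    exact hM y hy
  have hi : ∀ f : Lp ℝ p (volume : Measure (EuclideanSpace ℝ (Fin n))),
      IntegrableOn (fun y => f y • k y) Ω := fun f =>
    ((integrableOn_Lp hΩ f).norm.mul_const M).mono'
      ((integrableOn_Lp hΩ f).1.smul hk.aestronglyMeasurable) (hb f)
  refine ⟨LinearMap.mkContinuous
    { toFun := fun f => ∫ y in Ω, f y • k y
      map_add' := fun f f' => ?_
      map_smul' := fun c f => ?_ } (C * |M|) fun f => ?_, fun f => rfl⟩
  · rw [← integral_add (hi f) (hi f')]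
    refine integral_congr_ae ?_
    filter_upwards [ae_restrict_of_ae (Lp.coeFn_add f f')] with y hy
    rw [hy, Pi.add_apply, add_smul]
  · rw [← integral_smul]
    refine integral_congr_ae ?_
    filter_upwards [ae_restrict_of_ae (Lp.coeFn_smul c f)] with y hy
    rw [hy, Pi.smul_apply, smul_assoc, RingHom.id_apply]
  · change ‖∫ y in Ω, f y • k y‖ ≤ _
    calc ‖∫ y in Ω, f y • k y‖ ≤ ∫ y in Ω, ‖f y‖ * M :=
          norm_integral_le_of_norm_le ((integrableOn_Lp hΩ f).norm.mul_const M) (hb f)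
      _ = (∫ y in Ω, ‖f y‖) * M := integral_mul_const _ _
      _ ≤ (∫ y in Ω, ‖f y‖) * |M| := by gcongr; exact le_abs_self M
      _ ≤ C * ‖f‖ * |M| := by gcongr; exact hC f
      _ = C * |M| * ‖f‖ := by ring

theorem rieszPotential_indicator {n : ℕ} {α : ℝ} {Ω : Set (EuclideanSpace ℝ (Fin n))}
    (hΩm : MeasurableSet Ω) (f : EuclideanSpace ℝ (Fin n) → ℝ) (x : EuclideanSpace ℝ (Fin n)) :
    rieszPotential α (Ω.indicator f) x
      = rieszConst n α • ∫ y in Ω, f y • rieszKernel α (y - x) := by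
  rw [rieszPotential, ← integral_indicator hΩm]
  congr 2
  ext1 y
  by_cases hy : y ∈ Ω <;> simp [hy]

theorem tendsto_rieszPotential_indicator {n : ℕ} {α : ℝ} (hα : 0 < α) {p : ℝ≥0∞} [Fact (1 ≤ p)]
    {Ω : Set (EuclideanSpace ℝ (Fin n))} (hΩ : Bornology.IsBounded Ω) (hΩm : MeasurableSet Ω)
    {f : ℕ → Lp ℝ p (volume : Measure (EuclideanSpace ℝ (Fin n)))} (hf : WeakSeqTendsto f 0)
    {x : EuclideanSpace ℝ (Fin n)} {δ : ℝ} (hδ : 0 < δ) (hx : ∀ y ∈ Ω, δ ≤ ‖x - y‖) :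
    Tendsto (fun j => rieszPotential α (Ω.indicator (f j)) x) atTop (𝓝 0) := by
  obtain ⟨T, hT⟩ := exists_clm_setIntegral_smul (p := p) hΩ hΩm
    (k := fun y => rieszKernel α (y - x))
    ((measurable_rieszKernel α).comp (measurable_id.sub_const x))
    (fun y hy => norm_rieszKernel_le_of_le hα hδ (by rw [norm_sub_rev]; exact hx y hy))
  simp only [rieszPotential_indicator hΩm, ← hT]
  simpa using (hf.tendsto_clm_euclidean T).const_smul (rieszConst n α)

/-- Dominated convergence to zero in `L^p`. -/
theorem tendsto_eLpNorm_zero_of_dominated {X F : Type*} [MeasurableSpace X] {μ : Measure X}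
    [NormedAddCommGroup F] {p : ℝ≥0∞} (hp0 : p ≠ 0) (hp : p ≠ ⊤) {f : ℕ → X → F} {b : X → ℝ}
    (hb : MemLp b p μ) (hf : ∀ j, AEStronglyMeasurable (f j) μ)
    (hle : ∀ j, ∀ᵐ x ∂μ, ‖f j x‖ ≤ b x)
    (hlim : ∀ᵐ x ∂μ, Tendsto (fun j => f j x) atTop (𝓝 0)) :
    Tendsto (fun j => eLpNorm (f j) p μ) atTop (𝓝 0) := by
  have hpos : 0 < p.toReal := ENNReal.toReal_pos hp0 hp
  simp only [eLpNorm_eq_lintegral_rpow_enorm_toReal hp0 hp]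
  have key : Tendsto (fun j => ∫⁻ x, ‖f j x‖ₑ ^ p.toReal ∂μ) atTop
      (𝓝 (∫⁻ _, 0 ∂μ)) := by
    refine tendsto_lintegral_of_dominated_convergence' (fun x => ‖b x‖ₑ ^ p.toReal)
      (fun j => (hf j).enorm.pow_const _) (fun j => ?_)
      (lintegral_rpow_enorm_lt_top_of_eLpNorm_lt_top hp0 hp hb.2).ne ?_
    · filter_upwards [hle j] with x hx
      gcongr
      exact enorm_le_iff_norm_le.2 (hx.trans (le_abs_self _))
    · filter_upwards [hlim] with x hx
      have := (ENNReal.continuous_rpow_const (y := p.toReal)).tendsto 0 |>.comp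
        (by simpa using hx.enorm)
      simpa [ENNReal.zero_rpow_of_pos hpos, Function.comp_def] using this
  rw [lintegral_zero] at key
  have := ((ENNReal.continuous_rpow_const (y := 1 / p.toReal)).tendsto 0).comp key
  rwa [ENNReal.zero_rpow_of_pos (by positivity)] at this

theorem memLp_one_add_norm_rpow_neg {n : ℕ} {α : ℝ} (hα : 0 < α) {p : ℝ≥0∞} (hp1 : 1 ≤ p)
    (hp : p ≠ ⊤) :
    MemLp (fun x : EuclideanSpace ℝ (Fin n) => (1 + ‖x‖) ^ (-((n : ℝ) + α))) p volume := by
  have hp1' : 1 ≤ p.toReal := by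
    rw [← ENNReal.toReal_one]
    exact (ENNReal.toReal_le_toReal ENNReal.one_ne_top hp).2 hp1
  have hm : AEStronglyMeasurable
      (fun x : EuclideanSpace ℝ (Fin n) => (1 + ‖x‖) ^ (-((n : ℝ) + α))) volume := by
    apply Measurable.aestronglyMeasurable
    fun_prop
  rw [← integrable_norm_rpow_iff hm (by positivity) hp]
  have h0 : (0 : ℝ) ≤ n := n.cast_nonneg
  refine (integrable_one_add_norm (E := EuclideanSpace ℝ (Fin n)) (μ := volume)
    (r := ((n : ℝ) + α) * p.toReal) ?_).congr (.of_forall fun x => ?_)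
  · rw [finrank_euclideanSpace_fin]
    nlinarith
  · have : 0 ≤ 1 + ‖x‖ := by positivity
    simp only
    rw [Real.norm_of_nonneg (by positivity), ← Real.rpow_mul this, neg_mul]

/-- Dominated convergence for the potentials: with `f j` weakly null in `L^p`, the potentials tend
to zero pointwise and are bounded by a multiple of `(1 + |x|)^{-(n+α)}`. -/
theorem tendsto_eLpNorm_rieszPotential_indicator {n : ℕ} {α : ℝ} (hα : 0 < α)
    {p : ℝ≥0∞} [Fact (1 ≤ p)] (hp : p ≠ ⊤) {Ω U : Set (EuclideanSpace ℝ (Fin n))}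
    (hΩ : Bornology.IsBounded Ω) (hΩm : MeasurableSet Ω) (hUm : MeasurableSet U)
    {δ : ℝ} (hδ : 0 < δ) (hsep : ∀ x ∈ U, ∀ y ∈ Ω, δ ≤ ‖x - y‖)
    {f : ℕ → Lp ℝ p (volume : Measure (EuclideanSpace ℝ (Fin n)))} (hf : WeakSeqTendsto f 0) :
    Tendsto (fun j => eLpNorm (rieszPotential α (Ω.indicator (f j))) p (volume.restrict U))
      atTop (𝓝 0) := by
  have hp1 : 1 ≤ p := Fact.out
  obtain ⟨D, hD0, hD⟩ := exists_mul_one_add_norm_le hΩ hδ hsep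
  obtain ⟨B, hB⟩ := hf.exists_norm_le
  obtain ⟨C, hC0, hC⟩ := exists_setIntegral_norm_le (p := p) hΩ
  have hint : ∀ j, Integrable (Ω.indicator (f j)) := fun j =>
    (integrable_indicator_iff hΩm).2 (integrableOn_Lp hΩ (f j))
  have hmem : ∀ j y, Ω.indicator (f j) y ≠ 0 → y ∈ Ω := fun j y =>
    Set.mem_of_indicator_ne_zero
  refine tendsto_eLpNorm_zero_of_dominated (by positivity) hp
    (b := fun x => (‖rieszConst n α‖ * (C * B * (D ^ ((n : ℝ) + α))⁻¹))
      * (1 + ‖x‖) ^ (-((n : ℝ) + α)))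
    (((memLp_one_add_norm_rpow_neg hα hp1 hp).restrict U).const_mul _)
    (fun j => (aestronglyMeasurable_rieszPotential (hint j).1).restrict) (fun j => ?_) ?_
  · filter_upwards [ae_restrict_mem hUm] with x hx
    have hx0 : 0 < 1 + ‖x‖ := by positivity
    refine (norm_rieszPotential_le hα (hint j) (mul_pos hD0 hx0)
      fun y hy => hD x hx y (hmem j y hy)).trans ?_
    rw [Real.mul_rpow hD0.le hx0.le, mul_inv, Real.rpow_neg hx0.le, mul_assoc, mul_assoc (C * B)]
    gcongr
    calc ∫ y, ‖Ω.indicator (f j) y‖ = ∫ y in Ω, ‖f j y‖ := by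
          rw [← integral_indicator hΩm]
          simp only [norm_indicator_eq_indicator_norm]
      _ ≤ C * ‖f j‖ := hC (f j)
      _ ≤ C * B := by gcongr; exact hB j
  · filter_upwards [ae_restrict_mem hUm] with x hx
    exact tendsto_rieszPotential_indicator hα hΩ hΩm hf hδ (hsep x hx)

theorem fracSobolevCompl_sub_ae_eq_indicator {n : ℕ} {α : ℝ} {p : ℝ≥0∞}
    {Ω : Set (EuclideanSpace ℝ (Fin n))}
    {g u u' : Lp ℝ p (volume : Measure (EuclideanSpace ℝ (Fin n)))}
    (hu : u ∈ fracSobolevCompl α p Ω g) (hu' : u' ∈ fracSobolevCompl α p Ω g) :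
    (⇑u - ⇑u') =ᵐ[volume] Ω.indicator ⇑(u - u') := by
  obtain ⟨w, hw, rfl⟩ := hu
  obtain ⟨w', hw', rfl⟩ := hu'
  filter_upwards [hw.2, hw'.2, Lp.coeFn_add g w, Lp.coeFn_add g w',
    Lp.coeFn_sub (g + w) (g + w')] with x h1 h2 h3 h4 h5
  by_cases hx : x ∈ Ω
  · rw [Set.indicator_of_mem hx, h5]
  · rw [Set.indicator_of_notMem hx, Pi.sub_apply, h3, h4, Pi.add_apply, Pi.add_apply, h1 hx,
      h2 hx, sub_self]

theorem lemma2p8 {n : ℕ} {α : ℝ} (hα0 : 0 < α) (hα1 : α < 1)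
    {p : ℝ≥0∞} [Fact (1 ≤ p)] (hp : p ≠ ⊤)
    {Ω : Set (EuclideanSpace ℝ (Fin n))} (hΩo : IsOpen Ω) (hΩb : Bornology.IsBounded Ω)
    {g : Lp ℝ p (volume : Measure (EuclideanSpace ℝ (Fin n)))} (hg : g ∈ fracSobolev n α p)
    {u : ℕ → Lp ℝ p (volume : Measure (EuclideanSpace ℝ (Fin n)))}
    {u₀ : Lp ℝ p (volume : Measure (EuclideanSpace ℝ (Fin n)))}
    (hu : FracComplWeakTendsto α Ω g u u₀) :
    ∀ Ω' : Set (EuclideanSpace ℝ (Fin n)), IsOpen Ω' → CompactlyContained Ω Ω' →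
      Tendsto
        (fun j => eLpNorm (fun x => weakGrad α (u j) x - weakGrad α u₀ x) p
          (volume.restrict Ω'ᶜ))
        atTop (𝓝 0) := by
  intro Ω' hΩ' hcc
  have hp1 : 1 ≤ p := Fact.out
  obtain ⟨huΩ, hu₀Ω, huS, hu₀S, hweak, -⟩ := hu
  rcases Nat.eq_zero_or_pos n with rfl | hn
  · -- on `ℝ⁰` every vector field is zero
    have h0 : ∀ j, (fun x => weakGrad α (u j) x - weakGrad α u₀ x) = 0 := fun j =>
      funext fun x => Subsingleton.elim _ _
    simp only [h0, eLpNorm_zero, tendsto_const_nhds]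
  obtain ⟨δ, hδ, hδΩ'⟩ := hcc.2.exists_cthickening_subset_open hΩ' hcc.1
  rw [Metric.cthickening_closure] at hδΩ'
  -- an open neighbourhood of `Ω'ᶜ` is needed because `∂Ω'` may have positive measure
  set U := (Metric.cthickening δ Ω)ᶜ with hU
  have hUo : IsOpen U := Metric.isClosed_cthickening.isOpen_compl
  have hsep : ∀ x ∈ U, ∀ y ∈ Ω, δ ≤ ‖x - y‖ := fun x hx y hy => by
    by_contra! h
    exact hx (Metric.mem_cthickening_of_dist_le x y δ Ω hy (by rw [dist_eq_norm]; exact h.le))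
  have hsub : Ω'ᶜ ⊆ U := Set.compl_subset_compl.2 hδΩ'
  have hΩm := hΩo.measurableSet
  have hrep : ∀ j, ∀ᵐ x, x ∈ U → weakGrad α (u j) x - weakGrad α u₀ x
      = rieszPotential α (Ω.indicator ⇑(u j - u₀)) x := fun j =>
    ((isWeakRieszGrad_weakGrad (huS j)).sub hn hα0 hα1 hp1 hp (Lp.memLp (u j)) (Lp.memLp u₀)
      (isWeakRieszGrad_weakGrad hu₀S)).ae_eq_rieszPotential hα0
      (fracSobolevCompl_sub_ae_eq_indicator (huΩ j) hu₀Ω)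
      ((integrable_indicator_iff hΩm).2 (integrableOn_Lp hΩb (u j - u₀)))
      (fun y hy => Set.indicator_of_notMem hy _) hUo hδ hsep
  refine tendsto_of_tendsto_of_tendsto_of_le_of_le tendsto_const_nhds
    (tendsto_eLpNorm_rieszPotential_indicator hα0 hp hΩb hΩm hUo.measurableSet hδ hsep
      hweak.sub_const) (fun j => zero_le) fun j => ?_
  calc eLpNorm (fun x => weakGrad α (u j) x - weakGrad α u₀ x) p (volume.restrict Ω'ᶜ)
      ≤ eLpNorm (fun x => weakGrad α (u j) x - weakGrad α u₀ x) p (volume.restrict U) :=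
        eLpNorm_mono_measure _ (Measure.restrict_mono hsub le_rfl)
    _ = eLpNorm (rieszPotential α (Ω.indicator ⇑(u j - u₀))) p (volume.restrict U) :=
        eLpNorm_congr_ae ((ae_restrict_iff' hUo.measurableSet).2 (hrep j))

end
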